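/- Let $N,K$ be nonnegative integers. For $Z\in\mathbb{R}^{N\times K}$ with rows $z_1,\dots,z_N$ let $\ell_{2,1}(Z)=\sum_{n=1}^N\|z_n\|_2$, and for $\gamma\in[0,1]$ let \[ \mathit{ow}\ell_{2,1}(Z)=\ell_{2,1}\big(Z(Z^TZ)^{\dagger/2}\big),\qquad \Psi_\gamma(Z)=\ell_{2,1}\big(Z(\gamma I+(1-\gamma)Z^TZ)^{\dagger/2}\big), \] where $M^{\dagger/2}$ denotes the positive semidefinite square root of the Moore--Penrose pseudo-inverse $M^\dagger$ of a symmetric positive semidefinite matrix $M$. Let $\|\cdot\|_{\mathrm{Fro}}$ be the Frobenius norm and $\|\cdot\|_{\mathrm{op}}$ the operator norm induced by the Euclidean norm. Then: 1. $\Psi_1(Z)=\ell_{2,1}(Z)$ and $\Psi_0(Z)=\mathit{ow}\ell_{2,1}(Z)$ for all $Z\in\mathbb{R}^{N\times K}$. 2. For all $\gamma\in[0,1]$ and all $Z\in\mathbb{R}^{N\times K}$, $\sqrt{\gamma}\,\Psi_\gamma(Z)\le\ell_{2,1}(Z)$ and $\sqrt{1-\gamma}\,\Psi_\gamma(Z)\le\mathit{ow}\ell_{2,1}(Z)\le\sqrt{KN}$.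 3. For all $\gamma\in(0,1]$ and all $Z,\widehat Z\in\mathbb{R}^{N\times K}$, $|\Psi_\gamma(Z)-\Psi_\gamma(\widehat Z)|\le\sqrt{N/\gamma}\,\|Z-\widehat Z\|_{\mathrm{Fro}}$. 4. For all $Z,\widehat Z\in\mathbb{R}^{N\times K}$ such that $Z^TZ$ and $\widehat Z^T\widehat Z$ are invertible, \[ |\mathit{ow}\ell_{2,1}(Z)-\mathit{ow}\ell_{2,1}(\widehat Z)|\le\sqrt{N}\,\max\big\{\|(Z^TZ)^{-1/2}\|_{\mathrm{op}},\|(\widehat Z^T\widehat Z)^{-1/2}\|_{\mathrm{op}}\big\}\,\|Z-\widehat Z\|_{\mathrm{Fro}}. \] Moreover, $\mathit{ow}\ell_{2,1}$ is locally Lipschitz near every $\widehat Z$ with $\widehat Z^T\widehat Z$ invertible: for every $L>\sqrt N\,\|(\widehat Z^T\widehat Z)^{-1/2}\|_{\mathrm{op}}$ there is $\varepsilon>0$ such that every $Z$ in the open Frobenius ball of radius $\varepsilon$ about $\widehat Z$ has $Z^TZ$ invertible, and $|\mathit{ow}\ell_{2,1}(Z)-\mathit{ow}\ell_{2,1}(Z')|\le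 L\|Z-Z'\|_{\mathrm{Fro}}$ for all $Z,Z'$ in that ball. -/

import Mathlib

namespace OWL

open scoped Matrix MatrixOrder

/-- The four Penrose equations: `X` is a Moore-Penrose pseudo-inverse of the real matrix `A`. -/
structure IsMoorePenrose {m n : ℕ} (A : Matrix (Fin m) (Fin n) ℝ)
    (X : Matrix (Fin n) (Fin m) ℝ) : Prop where
  mul_mul_left : A * X * A = A
  mul_mul_right : X * A * X = X
  symm_left : (A * X)ᵀ = A * X
  symm_right : (X * A)ᵀ = X * A

theorem IsMoorePenrose.unique {m n : ℕ} {A : Matrix (Fin m) (Fin n) ℝ}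
    {X Y : Matrix (Fin n) (Fin m) ℝ} (hX : IsMoorePenrose A X) (hY : IsMoorePenrose A Y) :
    X = Y := by
  have e1 : A * X = A * Y := by
    calc A * X = (A * Y * A) * X := by rw [hY.mul_mul_left]
      _ = (A * Y)ᵀ * (A * X)ᵀ := by rw [hY.symm_left, hX.symm_left, Matrix.mul_assoc (A * Y)]
      _ = (A * X * A * Y)ᵀ := by rw [← Matrix.transpose_mul]; simp only [Matrix.mul_assoc]
      _ = A * Y := by rw [hX.mul_mul_left, hY.symm_left]
  have e2 : X * A = Y * A := by
    calc X * A = X * (A * Y * A) := by rw [hY.mul_mul_left]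
      _ = (X * A)ᵀ * (Y * A)ᵀ := by rw [hY.symm_right, hX.symm_right]; simp only [Matrix.mul_assoc]
      _ = (Y * (A * X * A))ᵀ := by rw [← Matrix.transpose_mul]; simp only [Matrix.mul_assoc]
      _ = Y * A := by rw [hX.mul_mul_left, hY.symm_right]
  calc X = X * A * X := hX.mul_mul_right.symm
    _ = Y * (A * X) := by rw [e2, Matrix.mul_assoc]
    _ = Y := by rw [e1, ← Matrix.mul_assoc, hY.mul_mul_right]

theorem exists_isMoorePenrose_of_isHermitian {n : ℕ} {A : Matrix (Fin n) (Fin n) ℝ}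
    (hA : A.IsHermitian) : ∃ X, X.IsHermitian ∧ IsMoorePenrose A X := by
  obtain ⟨U, d, hUU, hspec⟩ : ∃ (U : Matrix (Fin n) (Fin n) ℝ) (d : Fin n → ℝ),
      Uᵀ * U = 1 ∧ A = U * Matrix.diagonal d * Uᵀ := by
    refine ⟨(hA.eigenvectorUnitary : Matrix (Fin n) (Fin n) ℝ), hA.eigenvalues, ?_, ?_⟩
    · have h := Unitary.coe_star_mul_self hA.eigenvectorUnitary
      simpa [Matrix.star_eq_conjTranspose, Matrix.conjTranspose_eq_transpose_of_trivial] using h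
    · have h := hA.spectral_theorem
      rw [Unitary.conjStarAlgAut_apply] at h
      simpa [Matrix.star_eq_conjTranspose, Matrix.conjTranspose_eq_transpose_of_trivial,
        Function.comp_def] using h
  have key : ∀ a b : Fin n → ℝ, (U * Matrix.diagonal a * Uᵀ) * (U * Matrix.diagonal b * Uᵀ)
      = U * Matrix.diagonal (fun i => a i * b i) * Uᵀ := by
    intro a b
    calc (U * Matrix.diagonal a * Uᵀ) * (U * Matrix.diagonal b * Uᵀ)
        = U * Matrix.diagonal a * (Uᵀ * U) * Matrix.diagonal b * Uᵀ := by
          simp only [Matrix.mul_assoc]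
      _ = U * Matrix.diagonal (fun i => a i * b i) * Uᵀ := by
          rw [hUU, Matrix.mul_one, Matrix.mul_assoc U, Matrix.diagonal_mul_diagonal]
  have hsymm : ∀ a : Fin n → ℝ, (U * Matrix.diagonal a * Uᵀ)ᵀ = U * Matrix.diagonal a * Uᵀ := by
    intro a
    simp [Matrix.transpose_mul, Matrix.mul_assoc]
  refine ⟨U * Matrix.diagonal (fun i => (d i)⁻¹) * Uᵀ, ?_, ?_, ?_, ?_, ?_⟩
  · rw [Matrix.IsHermitian, Matrix.conjTranspose_eq_transpose_of_trivial, hsymm]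
  · rw [hspec, key, key]
    simp
  · rw [hspec, key, key]
    congr 3
    funext i
    by_cases h : d i = 0 <;> simp [h]
  · rw [hspec, key, hsymm]
  · rw [hspec, key, hsymm]

/-- Every real matrix has a Moore-Penrose pseudo-inverse. -/
theorem exists_isMoorePenrose {m n : ℕ} (A : Matrix (Fin m) (Fin n) ℝ) :
    ∃ X, IsMoorePenrose A X := by
  have hG : (Aᵀ * A).IsHermitian := by
    simp [Matrix.IsHermitian, Matrix.conjTranspose_eq_transpose_of_trivial]
  obtain ⟨G, hGs, h⟩ := exists_isMoorePenrose_of_isHermitian hG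
  have hGt : Gᵀ = G := by
    simpa [Matrix.IsHermitian, Matrix.conjTranspose_eq_transpose_of_trivial] using hGs
  have hz : A * (G * (Aᵀ * A)) = A := by
    have h0 : A * (G * (Aᵀ * A) - 1) = 0 := by
      rw [← Matrix.conjTranspose_mul_self_eq_zero, Matrix.conjTranspose_eq_transpose_of_trivial,
        Matrix.transpose_mul]
      have h1 : Aᵀ * (A * (G * (Aᵀ * A) - 1)) = 0 := by
        have h2 := h.mul_mul_left
        rw [Matrix.mul_assoc] at h2
        rw [← Matrix.mul_assoc, Matrix.mul_sub, h2, Matrix.mul_one, sub_self]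
      rw [Matrix.mul_assoc, h1, Matrix.mul_zero]
    rw [Matrix.mul_sub, Matrix.mul_one, sub_eq_zero] at h0
    exact h0
  refine ⟨G * Aᵀ, ?_, ?_, ?_, ?_⟩
  · rw [Matrix.mul_assoc, Matrix.mul_assoc, hz]
  · calc G * Aᵀ * A * (G * Aᵀ) = (G * (Aᵀ * A) * G) * Aᵀ := by simp only [Matrix.mul_assoc]
      _ = G * Aᵀ := by rw [h.mul_mul_right]
  · simp [Matrix.transpose_mul, hGt, Matrix.mul_assoc]
  · rw [Matrix.mul_assoc, h.symm_right]

noncomputable section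

/-- The Moore-Penrose pseudo-inverse `A†`. -/
def pinv {m n : ℕ} (A : Matrix (Fin m) (Fin n) ℝ) : Matrix (Fin n) (Fin m) ℝ :=
  Classical.choose (exists_isMoorePenrose A)

theorem pinv_spec {m n : ℕ} (A : Matrix (Fin m) (Fin n) ℝ) : IsMoorePenrose A (pinv A) :=
  Classical.choose_spec (exists_isMoorePenrose A)

/-- The positive semidefinite square root `M^{1/2}` of a positive semidefinite matrix `M`. -/
def msqrt {n : ℕ} (M : Matrix (Fin n) (Fin n) ℝ) : Matrix (Fin n) (Fin n) ℝ := CFC.sqrt M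

/-- `ℓ_{2,1}(Z)`: the sum of the Euclidean norms of the rows of `Z`. -/
def l21 {N K : ℕ} (Z : Matrix (Fin N) (Fin K) ℝ) : ℝ := ∑ n, √(∑ k, Z n k ^ 2)

/-- The Frobenius norm. -/
def fro {N K : ℕ} (Z : Matrix (Fin N) (Fin K) ℝ) : ℝ := √(∑ n, ∑ k, Z n k ^ 2)

/-- The operator norm of a square matrix acting on Euclidean space. -/
def opNorm {n : ℕ} (M : Matrix (Fin n) (Fin n) ℝ) : ℝ :=
  ‖Matrix.toEuclideanCLM (n := Fin n) (𝕜 := ℝ) M‖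

/-- The orthogonally weighted norm `owℓ_{2,1}(Z) = ℓ_{2,1}(Z (ZᵀZ)^{†/2})`. -/
def owl21 {N K : ℕ} (Z : Matrix (Fin N) (Fin K) ℝ) : ℝ := l21 (Z * msqrt (pinv (Zᵀ * Z)))

/-- `Ψ_γ(Z) = ℓ_{2,1}(Z (γ I + (1 - γ) ZᵀZ)^{†/2})`. -/
def Psi {N K : ℕ} (γ : ℝ) (Z : Matrix (Fin N) (Fin K) ℝ) : ℝ :=
  l21 (Z * msqrt (pinv (γ • (1 : Matrix (Fin K) (Fin K) ℝ) + (1 - γ) • (Zᵀ * Z))))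

/-- `‖(ZᵀZ)^{-1/2}‖_op`, meaningful when `ZᵀZ` is invertible; it is then the inverse of the
smallest singular value of `Z`. -/
def invSqrtNorm {N K : ℕ} (Z : Matrix (Fin N) (Fin K) ℝ) : ℝ := opNorm (msqrt (Zᵀ * Z)⁻¹)

end

end OWL

namespace OWL

open scoped Matrix MatrixOrder

/-! The upper bounds become scalar after passing to an eigenbasis of `Zᵀ * Z`: the weights are
explicit functions of the eigenvalues, and the squared column norms of `Z * V` are those
eigenvalues. For the Lipschitz estimates, `Z (γ I + (1 - γ) ZᵀZ)^{†/2}` is the off-diagonal block of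
the odd function `x ↦ x * weight γ (x ^ 2)` of the symmetric dilation `[[0, Z], [Zᵀ, 0]]`
(`dilation_function_apply`). A scalar Lipschitz bound between two spectra passes to functions of
symmetric matrices in Frobenius norm with the same constant (`sum_sq_conj_diagonal_sub_le`), and
Cauchy-Schwarz over the rows contributes `√N`. For `γ > 0` the scalar function is globally
`1/√γ`-Lipschitz. For `γ = 0` it is the sign function, which is Lipschitz only on spectra with a gap
around zero; a lower bound on the singular values supplies the gap, and this bound is stable under
small perturbations. -/

theorem sum_sq_eq_trace {ι κ : Type*} [Fintype ι] [Fintype κ] (M : Matrix ι κ ℝ) :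
    ∑ i, ∑ j, M i j ^ 2 = (M * Mᵀ).trace := by
  simp [Matrix.trace, Matrix.mul_apply, sq]

/-! ### Functions of symmetric matrices and the Frobenius norm -/

section Spectral

variable {ι κ : Type*} [Fintype ι] [DecidableEq ι] [Fintype κ] [DecidableEq κ]

/-- The spectral theorem for real symmetric matrices. -/
theorem exists_spectral_decomposition {A : Matrix ι ι ℝ} (hA : Aᵀ = A) :
    ∃ (U : Matrix ι ι ℝ) (d : ι → ℝ), Uᵀ * U = 1 ∧ U * Uᵀ = 1 ∧
      A = U * Matrix.diagonal d * Uᵀ := by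
  have hA' : A.IsHermitian := by
    rwa [Matrix.IsHermitian, Matrix.conjTranspose_eq_transpose_of_trivial]
  have h1 : (hA'.eigenvectorUnitary : Matrix ι ι ℝ)ᵀ * hA'.eigenvectorUnitary = 1 := by
    have h := Unitary.coe_star_mul_self hA'.eigenvectorUnitary
    simpa [Matrix.star_eq_conjTranspose, Matrix.conjTranspose_eq_transpose_of_trivial] using h
  refine ⟨(hA'.eigenvectorUnitary : Matrix ι ι ℝ), hA'.eigenvalues, h1,
    mul_eq_one_comm.mp h1, ?_⟩
  have h := hA'.spectral_theorem
  rw [Unitary.conjStarAlgAut_apply] at h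
  simpa [Matrix.star_eq_conjTranspose, Matrix.conjTranspose_eq_transpose_of_trivial,
    Function.comp_def] using h

theorem conj_diagonal_mul {U : Matrix ι ι ℝ} (hU : Uᵀ * U = 1) (a b : ι → ℝ) :
    (U * Matrix.diagonal a * Uᵀ) * (U * Matrix.diagonal b * Uᵀ)
      = U * Matrix.diagonal (fun i => a i * b i) * Uᵀ := by
  calc (U * Matrix.diagonal a * Uᵀ) * (U * Matrix.diagonal b * Uᵀ)
      = U * Matrix.diagonal a * (Uᵀ * U) * Matrix.diagonal b * Uᵀ := by
        simp only [Matrix.mul_assoc]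
    _ = U * Matrix.diagonal (fun i => a i * b i) * Uᵀ := by
        rw [hU, Matrix.mul_one, Matrix.mul_assoc U, Matrix.diagonal_mul_diagonal]

theorem conj_diagonal_transpose (U : Matrix ι ι ℝ) (a : ι → ℝ) :
    (U * Matrix.diagonal a * Uᵀ)ᵀ = U * Matrix.diagonal a * Uᵀ := by
  simp [Matrix.transpose_mul, Matrix.mul_assoc]

/-- Functions of symmetric matrices respect intertwining relations. -/
theorem conj_diagonal_intertwine {U : Matrix ι ι ℝ} {V : Matrix κ κ ℝ}
    (hU : Uᵀ * U = 1) (hU' : U * Uᵀ = 1) (hV : Vᵀ * V = 1) (hV' : V * Vᵀ = 1)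
    {a : ι → ℝ} {b : κ → ℝ} {X : Matrix ι κ ℝ}
    (h : (U * Matrix.diagonal a * Uᵀ) * X = X * (V * Matrix.diagonal b * Vᵀ)) (g : ℝ → ℝ) :
    (U * Matrix.diagonal (fun i => g (a i)) * Uᵀ) * X
      = X * (V * Matrix.diagonal (fun j => g (b j)) * Vᵀ) := by
  have h1 : Matrix.diagonal a * (Uᵀ * X * V) = (Uᵀ * X * V) * Matrix.diagonal b := by
    calc Matrix.diagonal a * (Uᵀ * X * V)
        = (Uᵀ * U) * Matrix.diagonal a * (Uᵀ * X * V) := by rw [hU, Matrix.one_mul]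
      _ = Uᵀ * ((U * Matrix.diagonal a * Uᵀ) * X) * V := by simp only [Matrix.mul_assoc]
      _ = Uᵀ * X * V * Matrix.diagonal b * (Vᵀ * V) := by rw [h]; simp only [Matrix.mul_assoc]
      _ = _ := by rw [hV, Matrix.mul_one]
  have h2 : Matrix.diagonal (fun i => g (a i)) * (Uᵀ * X * V)
      = (Uᵀ * X * V) * Matrix.diagonal (fun j => g (b j)) := by
    ext i j
    have := congrFun (congrFun h1 i) j
    rw [Matrix.diagonal_mul, Matrix.mul_diagonal] at this ⊢
    -- An entry of the rotated intertwiner can be nonzero only where the two eigenvalues agree, and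
    -- there `g` agrees too.
    rcases eq_or_ne ((Uᵀ * X * V) i j) 0 with h0 | h0
    · rw [h0]; simp
    · have : a i = b j := by
        rw [mul_comm] at this
        exact mul_left_cancel₀ h0 this
      rw [this, mul_comm]
  calc (U * Matrix.diagonal (fun i => g (a i)) * Uᵀ) * X
      = U * (Matrix.diagonal (fun i => g (a i)) * (Uᵀ * X * V)) * Vᵀ := by
        simp only [Matrix.mul_assoc]; rw [hV', Matrix.mul_one]
    _ = (U * Uᵀ) * X * (V * Matrix.diagonal (fun j => g (b j)) * Vᵀ) := by
        rw [h2]; simp only [Matrix.mul_assoc]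
    _ = _ := by rw [hU', Matrix.one_mul]

theorem sum_sq_conj {U : Matrix ι ι ℝ} {V : Matrix κ κ ℝ}
    (hU : U * Uᵀ = 1) (hV : V * Vᵀ = 1) (M : Matrix ι κ ℝ) :
    ∑ i, ∑ j, (Uᵀ * M * V) i j ^ 2 = ∑ i, ∑ j, M i j ^ 2 := by
  rw [sum_sq_eq_trace, sum_sq_eq_trace]
  calc ((Uᵀ * M * V) * (Uᵀ * M * V)ᵀ).trace
      = (Uᵀ * (M * (V * Vᵀ) * Mᵀ * U)).trace := by
        simp only [Matrix.transpose_mul, Matrix.transpose_transpose, Matrix.mul_assoc]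
    _ = (M * Mᵀ * (U * Uᵀ)).trace := by
        rw [Matrix.trace_mul_comm, hV, Matrix.mul_one, Matrix.mul_assoc]
    _ = _ := by rw [hU, Matrix.mul_one]

/-- Scalar Lipschitz bounds pass to functions of symmetric matrices in the Frobenius norm. -/
theorem sum_sq_conj_diagonal_sub_le {U V : Matrix ι ι ℝ}
    (hU : Uᵀ * U = 1) (hU' : U * Uᵀ = 1) (hV : Vᵀ * V = 1) (hV' : V * Vᵀ = 1)
    {a b : ι → ℝ} {f : ℝ → ℝ} {C : ℝ} (hC : ∀ i j, |f (a i) - f (b j)| ≤ C * |a i - b j|) :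
    ∑ i, ∑ j, (U * Matrix.diagonal (fun i => f (a i)) * Uᵀ
        - V * Matrix.diagonal (fun i => f (b i)) * Vᵀ) i j ^ 2
      ≤ C ^ 2 * ∑ i, ∑ j, (U * Matrix.diagonal a * Uᵀ - V * Matrix.diagonal b * Vᵀ) i j ^ 2 := by
  -- Rotating by `U` on the left and `V` on the right turns the difference into eigenvalue gaps
  -- times the fixed matrix `Uᵀ * V`, so the bound can be checked entry by entry.
  have key : ∀ p q : ι → ℝ, ∀ i j,
      (Uᵀ * (U * Matrix.diagonal p * Uᵀ - V * Matrix.diagonal q * Vᵀ) * V) i j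
        = (p i - q j) * (Uᵀ * V) i j := by
    intro p q i j
    have : Uᵀ * (U * Matrix.diagonal p * Uᵀ - V * Matrix.diagonal q * Vᵀ) * V
        = Matrix.diagonal p * (Uᵀ * V) - (Uᵀ * V) * Matrix.diagonal q := by
      calc _ = (Uᵀ * U) * Matrix.diagonal p * (Uᵀ * V)
            - (Uᵀ * V) * Matrix.diagonal q * (Vᵀ * V) := by
            simp only [Matrix.mul_sub, Matrix.sub_mul, Matrix.mul_assoc]
        _ = _ := by rw [hU, hV, Matrix.one_mul, Matrix.mul_one]
    rw [this, Matrix.sub_apply, Matrix.diagonal_mul, Matrix.mul_diagonal]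
    ring
  rw [← sum_sq_conj hU' hV', ← sum_sq_conj hU' hV' (U * Matrix.diagonal a * Uᵀ - _),
    Finset.mul_sum]
  refine Finset.sum_le_sum fun i _ => ?_
  rw [Finset.mul_sum]
  refine Finset.sum_le_sum fun j _ => ?_
  rw [key, key, mul_pow, mul_pow, ← mul_assoc]
  refine mul_le_mul_of_nonneg_right ?_ (sq_nonneg _)
  rw [← sq_abs, ← sq_abs (a i - b j), ← mul_pow]
  exact pow_le_pow_left₀ (abs_nonneg _) (hC i j) 2

end Spectral

/-! ### Weighted Gram matrices in an eigenbasis -/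

/-- The convention `0⁻¹ = 0` is exactly the pseudo-inverse on the kernel, so the Penrose equations
hold entrywise and uniqueness applies. -/
theorem pinv_conj_diagonal {n : ℕ} {U : Matrix (Fin n) (Fin n) ℝ} (hU : Uᵀ * U = 1)
    (d : Fin n → ℝ) :
    pinv (U * Matrix.diagonal d * Uᵀ) = U * Matrix.diagonal (fun i => (d i)⁻¹) * Uᵀ := by
  refine (pinv_spec _).unique ⟨?_, ?_, ?_, ?_⟩
  · rw [conj_diagonal_mul hU, conj_diagonal_mul hU]
    simp
  · rw [conj_diagonal_mul hU, conj_diagonal_mul hU]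
    congr 3
    funext i
    by_cases h : d i = 0 <;> simp [h]
  · rw [conj_diagonal_mul hU, conj_diagonal_transpose]
  · rw [conj_diagonal_mul hU, conj_diagonal_transpose]

theorem msqrt_conj_diagonal {n : ℕ} {U : Matrix (Fin n) (Fin n) ℝ} (hU : Uᵀ * U = 1)
    {d : Fin n → ℝ} (hd : ∀ i, 0 ≤ d i) :
    msqrt (U * Matrix.diagonal d * Uᵀ) = U * Matrix.diagonal (fun i => √(d i)) * Uᵀ := by
  have hpos : ∀ e : Fin n → ℝ, (∀ i, 0 ≤ e i) → 0 ≤ U * Matrix.diagonal e * Uᵀ := by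
    intro e he
    rw [Matrix.nonneg_iff_posSemidef, ← Matrix.conjTranspose_eq_transpose_of_trivial U]
    exact (Matrix.PosSemidef.diagonal he).mul_mul_conjTranspose_same U
  refine CFC.sqrt_unique ?_ (hpos _ fun i => Real.sqrt_nonneg _)
  rw [conj_diagonal_mul hU]
  simp [hd, Real.mul_self_sqrt]

/-- The Gram matrix of `Z` has a spectral decomposition with nonnegative eigenvalues, whose
eigenvalues are the squared norms of the columns of `Z V`. -/
theorem exists_gram_decomposition {N K : ℕ} (Z : Matrix (Fin N) (Fin K) ℝ) :
    ∃ (V : Matrix (Fin K) (Fin K) ℝ) (b : Fin K → ℝ), Vᵀ * V = 1 ∧ V * Vᵀ = 1 ∧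
      Zᵀ * Z = V * Matrix.diagonal b * Vᵀ ∧ ∀ j, ∑ n, (Z * V) n j ^ 2 = b j := by
  obtain ⟨V, b, h1, h2, h3⟩ := exists_spectral_decomposition
    (A := Zᵀ * Z) (by simp [Matrix.transpose_mul])
  refine ⟨V, b, h1, h2, h3, fun j => ?_⟩
  have h4 : (Z * V)ᵀ * (Z * V) = Matrix.diagonal b := by
    calc (Z * V)ᵀ * (Z * V) = Vᵀ * (Zᵀ * Z) * V := by
          simp only [Matrix.transpose_mul, Matrix.mul_assoc]
      _ = (Vᵀ * V) * Matrix.diagonal b * (Vᵀ * V) := by rw [h3]; simp only [Matrix.mul_assoc]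
      _ = _ := by rw [h1, Matrix.one_mul, Matrix.mul_one]
  have h5 := congrFun (congrFun h4 j) j
  rw [Matrix.diagonal_apply_eq, Matrix.mul_apply] at h5
  rw [← h5]
  simp [sq]

/-- The spectral weight `t ↦ (γ + (1 - γ) t)^{†/2}`. -/
noncomputable def weight (γ t : ℝ) : ℝ := √((γ + (1 - γ) * t)⁻¹)

theorem msqrt_pinv_weighted_gram {K : ℕ} {G V : Matrix (Fin K) (Fin K) ℝ} {b : Fin K → ℝ} {γ : ℝ}
    (h0 : 0 ≤ γ) (h1 : γ ≤ 1) (hV : Vᵀ * V = 1) (hV' : V * Vᵀ = 1)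
    (hG : G = V * Matrix.diagonal b * Vᵀ) (hb : ∀ j, 0 ≤ b j) :
    msqrt (pinv (γ • (1 : Matrix (Fin K) (Fin K) ℝ) + (1 - γ) • G))
      = V * Matrix.diagonal (fun j => weight γ (b j)) * Vᵀ := by
  have h : γ • (1 : Matrix (Fin K) (Fin K) ℝ) + (1 - γ) • G
      = V * Matrix.diagonal (fun j => γ + (1 - γ) * b j) * Vᵀ := by
    have : Matrix.diagonal (fun j => γ + (1 - γ) * b j)
        = γ • (1 : Matrix (Fin K) (Fin K) ℝ) + (1 - γ) • Matrix.diagonal b := by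
      ext i j
      by_cases hij : i = j <;> simp [hij]
    rw [this, hG, Matrix.mul_add, Matrix.add_mul]
    simp [hV']
  rw [h, pinv_conj_diagonal hV, msqrt_conj_diagonal hV]
  · rfl
  · intro i
    have := mul_nonneg (sub_nonneg.mpr h1) (hb i)
    positivity

theorem owl21_eq_Psi_zero {N K : ℕ} (Z : Matrix (Fin N) (Fin K) ℝ) : owl21 Z = Psi 0 Z := by
  simp [Psi, owl21]

theorem Psi_one {N K : ℕ} (Z : Matrix (Fin N) (Fin K) ℝ) : Psi 1 Z = l21 Z := by
  obtain ⟨V, b, hV, hV', hG, hcol⟩ := exists_gram_decomposition Z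
  have hb : ∀ j, 0 ≤ b j := fun j => hcol j ▸ Finset.sum_nonneg fun _ _ => sq_nonneg _
  rw [Psi, msqrt_pinv_weighted_gram zero_le_one le_rfl hV hV' hG hb]
  simp [weight, hV']

/-- Row norms of `Z` times a function of its Gram matrix, in the eigenbasis. -/
theorem l21_mul_conj_diagonal {N K : ℕ} (Z : Matrix (Fin N) (Fin K) ℝ)
    {V : Matrix (Fin K) (Fin K) ℝ} (hV : Vᵀ * V = 1) (w : Fin K → ℝ) :
    l21 (Z * (V * Matrix.diagonal w * Vᵀ)) = ∑ n, √(∑ j, ((Z * V) n j * w j) ^ 2) := by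
  refine Finset.sum_congr rfl fun n _ => ?_
  congr 1
  have hrow : ∀ (X : Matrix (Fin N) (Fin K) ℝ), ∑ k, X n k ^ 2 = (X * Xᵀ) n n := by
    intro X
    simp [Matrix.mul_apply, sq]
  have h2 : ∀ j, (Z * V) n j * w j = (Z * V * Matrix.diagonal w) n j := by simp
  simp only [h2]
  rw [hrow, hrow]
  simp only [Matrix.transpose_mul, Matrix.transpose_transpose, Matrix.mul_assoc]
  rw [← Matrix.mul_assoc Vᵀ V, hV, Matrix.one_mul]

/-! ### Norm comparisons and upper bounds -/

theorem l21_le_sqrt_mul_fro {N K : ℕ} (Z : Matrix (Fin N) (Fin K) ℝ) :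
    l21 Z ≤ √(N : ℝ) * fro Z := by
  rw [fro, ← Real.sqrt_mul (Nat.cast_nonneg _)]
  apply Real.le_sqrt_of_sq_le
  have h := sq_sum_le_card_mul_sum_sq (s := (Finset.univ : Finset (Fin N)))
    (f := fun n => √(∑ k, Z n k ^ 2))
  simp only [Finset.card_univ, Fintype.card_fin] at h
  refine h.trans_eq ?_
  congr 1
  exact Finset.sum_congr rfl fun n _ => Real.sq_sqrt (Finset.sum_nonneg fun _ _ => sq_nonneg _)

theorem abs_l21_sub_le {N K : ℕ} (A B : Matrix (Fin N) (Fin K) ℝ) :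
    |l21 A - l21 B| ≤ l21 (A - B) := by
  rw [l21, l21, l21, ← Finset.sum_sub_distrib]
  refine (Finset.abs_sum_le_sum_abs _ _).trans (Finset.sum_le_sum fun n _ => ?_)
  have h : ∀ M : Matrix (Fin N) (Fin K) ℝ, √(∑ k, M n k ^ 2) = ‖WithLp.toLp 2 (M n)‖ := by
    intro M
    simp [EuclideanSpace.norm_eq]
  rw [h, h, h]
  exact abs_norm_sub_norm_le (WithLp.toLp 2 (A n)) (WithLp.toLp 2 (B n))

theorem Psi_upper_bounds {N K : ℕ} {γ : ℝ} (h0 : 0 ≤ γ) (h1 : γ ≤ 1)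
    (Z : Matrix (Fin N) (Fin K) ℝ) :
    √γ * Psi γ Z ≤ l21 Z ∧ √(1 - γ) * Psi γ Z ≤ owl21 Z ∧ owl21 Z ≤ √((K : ℝ) * N) := by
  obtain ⟨V, b, hV, hV', hG, hcol⟩ := exists_gram_decomposition Z
  have hb : ∀ j, 0 ≤ b j := fun j => hcol j ▸ Finset.sum_nonneg fun _ _ => sq_nonneg _
  have hPsi : ∀ δ : ℝ, 0 ≤ δ → δ ≤ 1 →
      Psi δ Z = ∑ n, √(∑ j, ((Z * V) n j * weight δ (b j)) ^ 2) := fun δ hδ hδ' => by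
    rw [Psi, msqrt_pinv_weighted_gram hδ hδ' hV hV' hG hb, l21_mul_conj_diagonal Z hV]
  have hw : ∀ (δ : ℝ) (j), 0 ≤ δ → δ ≤ 1 → weight δ (b j) ^ 2 = (δ + (1 - δ) * b j)⁻¹ :=
    fun δ j hδ hδ' => Real.sq_sqrt <| inv_nonneg.mpr <|
      add_nonneg hδ (mul_nonneg (sub_nonneg.mpr hδ') (hb j))
  -- At a zero eigenvalue the weight comparison can fail, since `0⁻¹ = 0`; the corresponding column
  -- vanishes, so no comparison is needed there.
  have hzero : ∀ n j, b j = 0 → (Z * V) n j = 0 := by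
    intro n j hj
    have := (Finset.sum_eq_zero_iff_of_nonneg fun _ _ => sq_nonneg _).mp ((hcol j).trans hj) n
      (Finset.mem_univ n)
    simpa using this
  have hscale : ∀ (c δ ε : ℝ), 0 ≤ c → 0 ≤ δ → δ ≤ 1 → 0 ≤ ε → ε ≤ 1 →
      (∀ j, b j ≠ 0 → c * (δ + (1 - δ) * b j)⁻¹ ≤ (ε + (1 - ε) * b j)⁻¹) →
      √c * Psi δ Z ≤ Psi ε Z := by
    intro c δ ε hc hδ hδ' hε hε' h
    rw [hPsi δ hδ hδ', hPsi ε hε hε', Finset.mul_sum]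
    refine Finset.sum_le_sum fun n _ => ?_
    rw [← Real.sqrt_mul hc, Finset.mul_sum]
    refine Real.sqrt_le_sqrt (Finset.sum_le_sum fun j _ => ?_)
    rw [mul_pow, mul_pow, hw δ j hδ hδ', hw ε j hε hε']
    rcases eq_or_ne (b j) 0 with hj | hj
    · simp [hzero n j hj]
    · nlinarith [mul_le_mul_of_nonneg_left (h j hj) (sq_nonneg ((Z * V) n j))]
  refine ⟨?_, ?_, ?_⟩
  · rw [← Psi_one]
    refine hscale γ γ 1 h0 h0 h1 zero_le_one le_rfl fun j _ => ?_
    have h2 := mul_nonneg (sub_nonneg.mpr h1) (hb j)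
    simp only [sub_self, zero_mul, add_zero, inv_one, ← div_eq_mul_inv]
    exact div_le_one_of_le₀ (by linarith) (by linarith)
  · rw [owl21_eq_Psi_zero]
    refine hscale (1 - γ) γ 0 (by linarith) h0 h1 le_rfl zero_le_one fun j hj => ?_
    have hbj : 0 < b j := lt_of_le_of_ne (hb j) hj.symm
    simp only [sub_zero, one_mul, zero_add, ← div_eq_mul_inv]
    rw [← one_div, le_div_iff₀ hbj, div_mul_eq_mul_div]
    exact div_le_one_of_le₀ (by linarith) (by nlinarith)
  · rw [owl21_eq_Psi_zero, hPsi 0 le_rfl zero_le_one]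
    refine (l21_le_sqrt_mul_fro (Matrix.of fun n j => (Z * V) n j * weight 0 (b j))).trans ?_
    rw [mul_comm (K : ℝ), Real.sqrt_mul (Nat.cast_nonneg _), fro]
    refine mul_le_mul_of_nonneg_left (Real.sqrt_le_sqrt ?_) (Real.sqrt_nonneg _)
    simp only [Matrix.of_apply]
    -- Summed by columns, each contribution is `b j * (b j)⁻¹ ≤ 1`.
    rw [Finset.sum_comm]
    calc ∑ j, ∑ n, ((Z * V) n j * weight 0 (b j)) ^ 2 ≤ ∑ _j : Fin K, (1 : ℝ) := by
          refine Finset.sum_le_sum fun j _ => ?_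
          simp only [mul_pow]
          rw [← Finset.sum_mul, hcol, hw 0 j le_rfl zero_le_one]
          simpa using mul_inv_le_one
      _ = K := by simp

/-! ### Scalar Lipschitz bound for positive `γ` -/

/-- With `p`, `q` the square roots in the denominators, multiplying `x q - y p` by its conjugate
cancels the `x² y²` terms and leaves `γ (x² - y²)`. The bounds `p, q ≥ √γ` do the rest. -/
theorem abs_mul_weight_sub_le_of_nonneg {γ x y : ℝ} (h0 : 0 < γ) (h1 : γ ≤ 1)
    (hy : 0 ≤ y) (hyx : y ≤ x) :
    |x * weight γ (x ^ 2) - y * weight γ (y ^ 2)| ≤ (√γ)⁻¹ * |x - y| := by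
  have hx : 0 ≤ x := hy.trans hyx
  have hs : 0 < √γ := Real.sqrt_pos.mpr h0
  have hss : √γ ^ 2 = γ := Real.sq_sqrt h0.le
  have hle : ∀ t : ℝ, γ ≤ γ + (1 - γ) * t ^ 2 := fun t => by
    have := mul_nonneg (sub_nonneg.mpr h1) (sq_nonneg t)
    linarith
  obtain ⟨p, hp⟩ : ∃ p, p = √(γ + (1 - γ) * x ^ 2) := ⟨_, rfl⟩
  obtain ⟨q, hq⟩ : ∃ q, q = √(γ + (1 - γ) * y ^ 2) := ⟨_, rfl⟩
  have hsp : √γ ≤ p := hp ▸ Real.sqrt_le_sqrt (hle x)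
  have hsq : √γ ≤ q := hq ▸ Real.sqrt_le_sqrt (hle y)
  have hpp : p ^ 2 = γ + (1 - γ) * x ^ 2 := hp ▸ Real.sq_sqrt (h0.le.trans (hle x))
  have hqq : q ^ 2 = γ + (1 - γ) * y ^ 2 := hq ▸ Real.sq_sqrt (h0.le.trans (hle y))
  have hp0 : 0 < p := hs.trans_le hsp
  have hq0 : 0 < q := hs.trans_le hsq
  rw [weight, weight, Real.sqrt_inv, Real.sqrt_inv, ← hp, ← hq]
  rcases eq_or_lt_of_le (add_nonneg hx hy) with hxy | hxy
  · obtain rfl : x = 0 := by linarith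
    obtain rfl : y = 0 := by linarith
    simp
  have hprod : (x * q - y * p) * (x * q + y * p) = √γ ^ 2 * ((x - y) * (x + y)) := by
    rw [hss]
    linear_combination x ^ 2 * hqq - y ^ 2 * hpp
  have hsum : √γ * (x + y) ≤ x * q + y * p := by
    nlinarith [mul_le_mul_of_nonneg_left hsq hx, mul_le_mul_of_nonneg_left hsp hy]
  have hsum0 : 0 < x * q + y * p := (mul_pos hs hxy).trans_le hsum
  have hdiff0 : 0 ≤ x * q - y * p := by
    refine nonneg_of_mul_nonneg_left ?_ hsum0
    rw [hprod]
    exact mul_nonneg (sq_nonneg _) (mul_nonneg (sub_nonneg.mpr hyx) hxy.le)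
  have hdiff : x * q - y * p ≤ √γ * (x - y) := by
    refine le_of_mul_le_mul_right ?_ (mul_pos hs hxy)
    calc (x * q - y * p) * (√γ * (x + y)) ≤ (x * q - y * p) * (x * q + y * p) :=
          mul_le_mul_of_nonneg_left hsum hdiff0
      _ = √γ * (x - y) * (√γ * (x + y)) := by rw [hprod]; ring
  have he : x * p⁻¹ - y * q⁻¹ = (x * q - y * p) / (p * q) := by
    field_simp
  rw [he, abs_of_nonneg (div_nonneg hdiff0 (mul_pos hp0 hq0).le),
    abs_of_nonneg (sub_nonneg.mpr hyx), div_le_iff₀ (mul_pos hp0 hq0)]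
  calc x * q - y * p ≤ √γ * (x - y) := hdiff
    _ = (√γ)⁻¹ * (x - y) * (√γ * √γ) := by field_simp
    _ ≤ (√γ)⁻¹ * (x - y) * (p * q) := by
        have := sub_nonneg.mpr hyx
        gcongr

theorem abs_mul_weight_sub_le {γ : ℝ} (h0 : 0 < γ) (h1 : γ ≤ 1) (x y : ℝ) :
    |x * weight γ (x ^ 2) - y * weight γ (y ^ 2)| ≤ (√γ)⁻¹ * |x - y| := by
  wlog hyx : y ≤ x generalizing x y
  · rw [abs_sub_comm, abs_sub_comm x]
    exact this y x (le_of_not_ge hyx)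
  rcases le_total 0 y with hy | hy
  · exact abs_mul_weight_sub_le_of_nonneg h0 h1 hy hyx
  rcases le_total x 0 with hx | hx
  · have h := abs_mul_weight_sub_le_of_nonneg h0 h1 (neg_nonneg.mpr hx) (neg_le_neg hyx)
    rw [neg_sq, neg_sq] at h
    convert h using 2 <;> ring_nf
  -- For opposite signs, compare each point with `0` and use `|x| + |y| = |x - y|`.
  · have hx' := abs_mul_weight_sub_le_of_nonneg h0 h1 le_rfl hx
    have hy' := abs_mul_weight_sub_le_of_nonneg h0 h1 le_rfl (neg_nonneg.mpr hy)
    rw [neg_sq] at hy'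
    simp only [zero_mul, sub_zero, neg_mul, abs_neg] at hx' hy'
    rw [abs_of_nonneg hx] at hx'
    rw [abs_of_nonpos hy] at hy'
    rw [abs_of_nonneg (sub_nonneg.mpr hyx)]
    refine (abs_sub _ _).trans ?_
    linarith

/-! ### Transfer through the dilation -/

/-- The Hermitian dilation of a real matrix. -/
def dilation {N K : ℕ} (Z : Matrix (Fin N) (Fin K) ℝ) :
    Matrix (Fin N ⊕ Fin K) (Fin N ⊕ Fin K) ℝ := Matrix.fromBlocks 0 Z Zᵀ 0

theorem exists_dilation_decomposition {N K : ℕ} (Z : Matrix (Fin N) (Fin K) ℝ) :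
    ∃ (U : Matrix (Fin N ⊕ Fin K) (Fin N ⊕ Fin K) ℝ) (a : Fin N ⊕ Fin K → ℝ),
      Uᵀ * U = 1 ∧ U * Uᵀ = 1 ∧ dilation Z = U * Matrix.diagonal a * Uᵀ :=
  exists_spectral_decomposition (by simp [dilation, Matrix.fromBlocks_transpose])

/-- The upper right block of an odd function of the dilation. -/
theorem dilation_function_apply {N K : ℕ} {Z : Matrix (Fin N) (Fin K) ℝ} {γ : ℝ}
    (h0 : 0 ≤ γ) (h1 : γ ≤ 1)
    {U : Matrix (Fin N ⊕ Fin K) (Fin N ⊕ Fin K) ℝ} {a : Fin N ⊕ Fin K → ℝ}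
    (hU : Uᵀ * U = 1) (hU' : U * Uᵀ = 1) (hH : dilation Z = U * Matrix.diagonal a * Uᵀ)
    (n : Fin N) (k : Fin K) :
    (U * Matrix.diagonal (fun i => a i * weight γ (a i ^ 2)) * Uᵀ) (Sum.inl n) (Sum.inr k)
      = (Z * msqrt (pinv (γ • (1 : Matrix (Fin K) (Fin K) ℝ) + (1 - γ) • (Zᵀ * Z)))) n k := by
  obtain ⟨V, b, hV, hV', hG, hcol⟩ := exists_gram_decomposition Z
  have hb : ∀ j, 0 ≤ b j := fun j => hcol j ▸ Finset.sum_nonneg fun _ _ => sq_nonneg _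
  rw [msqrt_pinv_weighted_gram h0 h1 hV hV' hG hb]
  -- `J` includes the second summand. Squaring the dilation gives `H² J = J ZᵀZ`, hence `w(H²) J = J
  -- w(ZᵀZ)`; one more factor `H` produces `Z w(ZᵀZ)` in the top block.
  obtain ⟨J, hJ⟩ : ∃ J : Matrix (Fin N ⊕ Fin K) (Fin K) ℝ, J = Matrix.fromRows 0 1 := ⟨_, rfl⟩
  have hHJ : dilation Z * J = Matrix.fromRows Z 0 := by
    rw [hJ, dilation, Matrix.fromBlocks_mul_fromRows]
    simp
  have hHHJ : (U * Matrix.diagonal (fun i => a i * a i) * Uᵀ) * J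
      = J * (V * Matrix.diagonal b * Vᵀ) := by
    rw [← conj_diagonal_mul hU, ← hH, ← hG, Matrix.mul_assoc, hHJ, hJ, dilation,
      Matrix.fromBlocks_mul_fromRows, Matrix.fromRows_mul]
    simp
  have hfJ : (U * Matrix.diagonal (fun i => a i * weight γ (a i ^ 2)) * Uᵀ) * J
      = Matrix.fromRows (Z * (V * Matrix.diagonal (fun j => weight γ (b j)) * Vᵀ)) 0 := by
    simp only [sq]
    rw [← conj_diagonal_mul hU, Matrix.mul_assoc _ _ J,
      conj_diagonal_intertwine hU hU' hV hV' hHHJ (weight γ), ← hH, ← Matrix.mul_assoc, hHJ,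
      Matrix.fromRows_mul, Matrix.zero_mul]
  have h := congrFun (congrFun hfJ (Sum.inl n)) k
  rw [Matrix.fromRows_apply_inl] at h
  rw [← h]
  generalize U * Matrix.diagonal (fun i => a i * weight γ (a i ^ 2)) * Uᵀ = F
  simp [hJ, Matrix.mul_apply, Matrix.one_apply]

/-- Scalar Lipschitz bounds on the spectra of the dilations give Lipschitz bounds for `Ψ_γ`. -/
theorem abs_Psi_sub_le {N K : ℕ} {Z Z' : Matrix (Fin N) (Fin K) ℝ} {γ C : ℝ}
    (h0 : 0 ≤ γ) (h1 : γ ≤ 1) (hC0 : 0 ≤ C)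
    {U U' : Matrix (Fin N ⊕ Fin K) (Fin N ⊕ Fin K) ℝ} {a a' : Fin N ⊕ Fin K → ℝ}
    (hU : Uᵀ * U = 1) (hUt : U * Uᵀ = 1) (hH : dilation Z = U * Matrix.diagonal a * Uᵀ)
    (hU' : U'ᵀ * U' = 1) (hUt' : U' * U'ᵀ = 1) (hH' : dilation Z' = U' * Matrix.diagonal a' * U'ᵀ)
    (hC : ∀ i j, |a i * weight γ (a i ^ 2) - a' j * weight γ (a' j ^ 2)| ≤ C * |a i - a' j|) :
    |Psi γ Z - Psi γ Z'| ≤ √(N : ℝ) * C * fro (Z - Z') := by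
  rw [mul_assoc]
  refine (abs_l21_sub_le _ _).trans ((l21_le_sqrt_mul_fro _).trans
    (mul_le_mul_of_nonneg_left ?_ (Real.sqrt_nonneg _)))
  set F := Z * msqrt (pinv (γ • (1 : Matrix (Fin K) (Fin K) ℝ) + (1 - γ) • (Zᵀ * Z))) with hF
  set F' := Z' * msqrt (pinv (γ • (1 : Matrix (Fin K) (Fin K) ℝ) + (1 - γ) • (Z'ᵀ * Z'))) with hF'
  have hmain := sum_sq_conj_diagonal_sub_le (f := fun x => x * weight γ (x ^ 2))
    hU hUt hU' hUt' hC
  rw [← hH, ← hH'] at hmain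
  set D := U * Matrix.diagonal (fun i => a i * weight γ (a i ^ 2)) * Uᵀ
    - U' * Matrix.diagonal (fun i => a' i * weight γ (a' i ^ 2)) * U'ᵀ with hD
  have hDt : Dᵀ = D := by
    rw [hD, Matrix.transpose_sub, conj_diagonal_transpose, conj_diagonal_transpose]
  have hD1 : ∀ n k, D (Sum.inl n) (Sum.inr k) = (F - F') n k := by
    intro n k
    rw [hD, Matrix.sub_apply, Matrix.sub_apply, dilation_function_apply h0 h1 hU hUt hH,
      dilation_function_apply h0 h1 hU' hUt' hH']
  have hD2 : ∀ n k, D (Sum.inr k) (Sum.inl n) = (F - F') n k := by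
    intro n k
    rw [← hD1, ← Matrix.transpose_apply D, hDt]
  -- Both off-diagonal blocks of `D` carry `F - F'`; the diagonal blocks are discarded as
  -- nonnegative. The factor 2 cancels against the one in `hright`.
  have hleft : 2 * ∑ n, ∑ k, (F - F') n k ^ 2 ≤ ∑ i, ∑ j, D i j ^ 2 := by
    simp only [Fintype.sum_sum_type, Finset.sum_add_distrib, hD1, hD2]
    rw [Finset.sum_comm (s := (Finset.univ : Finset (Fin K))) (t := (Finset.univ : Finset (Fin N)))]
    have e1 : 0 ≤ ∑ n : Fin N, ∑ m : Fin N, D (Sum.inl n) (Sum.inl m) ^ 2 := by positivity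
    have e2 : 0 ≤ ∑ n : Fin K, ∑ m : Fin K, D (Sum.inr n) (Sum.inr m) ^ 2 := by positivity
    linarith
  have hright : ∑ i, ∑ j, (dilation Z - dilation Z') i j ^ 2 = 2 * ∑ n, ∑ k, (Z - Z') n k ^ 2 := by
    simp only [Fintype.sum_sum_type, Finset.sum_add_distrib, dilation, Matrix.sub_apply,
      Matrix.fromBlocks_apply₁₁, Matrix.fromBlocks_apply₁₂, Matrix.fromBlocks_apply₂₁,
      Matrix.fromBlocks_apply₂₂, Matrix.transpose_apply, Matrix.zero_apply]
    rw [Finset.sum_comm (s := (Finset.univ : Finset (Fin K))) (t := (Finset.univ : Finset (Fin N)))]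
    simp
    ring
  rw [hright] at hmain
  rw [fro, fro, ← Real.sqrt_sq hC0, ← Real.sqrt_mul (sq_nonneg _)]
  exact Real.sqrt_le_sqrt (by linarith)

/-! ### Singular value gap -/

/-- The Euclidean norm of a coordinate vector. -/
noncomputable def euclNorm {n : ℕ} (y : Fin n → ℝ) : ℝ := ‖WithLp.toLp 2 y‖

theorem euclNorm_sq {n : ℕ} (y : Fin n → ℝ) : euclNorm y ^ 2 = y ⬝ᵥ y := by
  rw [euclNorm, EuclideanSpace.real_norm_sq_eq]
  simp [dotProduct, sq]

theorem euclNorm_nonneg {n : ℕ} (y : Fin n → ℝ) : 0 ≤ euclNorm y := norm_nonneg _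

theorem euclNorm_eq_zero {n : ℕ} {y : Fin n → ℝ} : euclNorm y = 0 ↔ y = 0 := by
  rw [euclNorm, norm_eq_zero, WithLp.toLp_eq_zero]

theorem euclNorm_add_le {n : ℕ} (x y : Fin n → ℝ) :
    euclNorm (x + y) ≤ euclNorm x + euclNorm y := norm_add_le (WithLp.toLp 2 x) (WithLp.toLp 2 y)

theorem euclNorm_mulVec_le_opNorm {n : ℕ} (M : Matrix (Fin n) (Fin n) ℝ) (x : Fin n → ℝ) :
    euclNorm (M *ᵥ x) ≤ opNorm M * euclNorm x :=
  (Matrix.toEuclideanCLM (n := Fin n) (𝕜 := ℝ) M).le_opNorm (WithLp.toLp 2 x)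

theorem euclNorm_mulVec_le_fro {N K : ℕ} (M : Matrix (Fin N) (Fin K) ℝ) (x : Fin K → ℝ) :
    euclNorm (M *ᵥ x) ≤ fro M * euclNorm x := by
  refine le_of_sq_le_sq ?_ (mul_nonneg (Real.sqrt_nonneg _) (euclNorm_nonneg _))
  rw [mul_pow, fro, Real.sq_sqrt (by positivity), euclNorm_sq, euclNorm_sq, Finset.sum_mul]
  refine Finset.sum_le_sum fun n _ => ?_
  have h := Finset.sum_mul_sq_le_sq_mul_sq Finset.univ (M n) x
  simpa [Matrix.mulVec, dotProduct, sq] using h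

theorem dotProduct_gram {N K : ℕ} (Z : Matrix (Fin N) (Fin K) ℝ) (y : Fin K → ℝ) :
    y ⬝ᵥ ((Zᵀ * Z) *ᵥ y) = euclNorm (Z *ᵥ y) ^ 2 := by
  rw [euclNorm_sq, ← Matrix.mulVec_mulVec, Matrix.dotProduct_mulVec, Matrix.vecMul_transpose]

/-- `c` bounds the inverse of the smallest singular value of `Z`. -/
def LowerBound {N K : ℕ} (c : ℝ) (Z : Matrix (Fin N) (Fin K) ℝ) : Prop :=
  ∀ y, euclNorm y ≤ c * euclNorm (Z *ᵥ y)

theorem LowerBound.mono {N K : ℕ} {c d : ℝ} {Z : Matrix (Fin N) (Fin K) ℝ}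
    (h : LowerBound c Z) (hcd : c ≤ d) : LowerBound d Z := fun y =>
  (h y).trans (mul_le_mul_of_nonneg_right hcd (euclNorm_nonneg _))

theorem LowerBound.isUnit {N K : ℕ} {c : ℝ} {Z : Matrix (Fin N) (Fin K) ℝ}
    (h : LowerBound c Z) : IsUnit (Zᵀ * Z) := by
  rw [← Matrix.mulVec_injective_iff_isUnit, ← Matrix.coe_mulVecLin,
    injective_iff_map_eq_zero]
  intro y hy
  rw [Matrix.mulVecLin_apply] at hy
  have h1 := dotProduct_gram Z y
  rw [hy, dotProduct_zero] at h1
  have h2 := h y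
  rw [pow_eq_zero_iff two_ne_zero |>.mp h1.symm, mul_zero] at h2
  exact euclNorm_eq_zero.mp (le_antisymm h2 (euclNorm_nonneg _))

/-- With `P = G^{-1/2}`, `y = P (P G y)`, and `P G y` has the same norm as `Z y`. -/
theorem lowerBound_invSqrtNorm {N K : ℕ} {Z : Matrix (Fin N) (Fin K) ℝ}
    (h : IsUnit (Zᵀ * Z)) : LowerBound (invSqrtNorm Z) Z := by
  intro y
  set G := Zᵀ * Z with hG
  set P := msqrt G⁻¹ with hP
  have hGpos : G⁻¹.PosSemidef := by
    have := Matrix.posSemidef_conjTranspose_mul_self Z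
    rw [Matrix.conjTranspose_eq_transpose_of_trivial] at this
    exact this.inv
  have hPP : P * P = G⁻¹ := CFC.sqrt_mul_sqrt_self _ hGpos.nonneg
  have hPt : Pᵀ = P := by
    have h1 : P.PosSemidef := Matrix.nonneg_iff_posSemidef.mp (CFC.sqrt_nonneg _)
    simpa [Matrix.IsHermitian, Matrix.conjTranspose_eq_transpose_of_trivial] using h1.isHermitian
  have hGG : G⁻¹ * G = 1 := Matrix.nonsing_inv_mul _ ((Matrix.isUnit_iff_isUnit_det _).mp h)
  have h1 : P *ᵥ (P *ᵥ (G *ᵥ y)) = y := by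
    rw [Matrix.mulVec_mulVec, hPP, Matrix.mulVec_mulVec, hGG, Matrix.one_mulVec]
  have h2 : euclNorm (P *ᵥ (G *ᵥ y)) = euclNorm (Z *ᵥ y) := by
    rw [← sq_eq_sq₀ (euclNorm_nonneg _) (euclNorm_nonneg _), ← dotProduct_gram,
      ← dotProduct_gram, ← hG, hPt, hPP, Matrix.mulVec_mulVec, hGG, Matrix.one_mulVec,
      dotProduct_comm]
  calc euclNorm y = euclNorm (P *ᵥ (P *ᵥ (G *ᵥ y))) := by rw [h1]
    _ ≤ opNorm P * euclNorm (P *ᵥ (G *ᵥ y)) := euclNorm_mulVec_le_opNorm _ _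
    _ = _ := by rw [h2]; rfl

/-- Nonzero eigenvalues of the dilation are bounded away from zero. -/
theorem LowerBound.eigenvalue {N K : ℕ} {c : ℝ} {Z : Matrix (Fin N) (Fin K) ℝ}
    (h : LowerBound c Z)
    {U : Matrix (Fin N ⊕ Fin K) (Fin N ⊕ Fin K) ℝ} {a : Fin N ⊕ Fin K → ℝ}
    (hU : Uᵀ * U = 1) (hH : dilation Z = U * Matrix.diagonal a * Uᵀ) (i : Fin N ⊕ Fin K) :
    a i = 0 ∨ 1 ≤ c * |a i| := by
  rw [or_iff_not_imp_left]
  intro hai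
  have hHU : dilation Z * U = U * Matrix.diagonal a := by
    rw [hH, Matrix.mul_assoc, hU, Matrix.mul_one]
  -- The two halves of an eigenvector satisfy `Z y = a x` and `Zᵀ x = a y`, whence `‖Z y‖ = |a|
  -- ‖y‖`. If `a ≠ 0`, then `y = 0` would force `x = 0`, impossible for a unit column.
  set x : Fin N → ℝ := fun n => U (Sum.inl n) i with hx
  set y : Fin K → ℝ := fun k => U (Sum.inr k) i with hy
  have h1 : Z *ᵥ y = a i • x := by
    ext n
    have := congrFun (congrFun hHU (Sum.inl n)) i
    rw [Matrix.mul_diagonal, Matrix.mul_apply] at this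
    simpa [dilation, Matrix.mulVec, dotProduct, hx, hy, mul_comm] using this
  have h2 : Zᵀ *ᵥ x = a i • y := by
    ext k
    have := congrFun (congrFun hHU (Sum.inr k)) i
    rw [Matrix.mul_diagonal, Matrix.mul_apply] at this
    simpa [dilation, Matrix.mulVec, dotProduct, hx, hy, mul_comm] using this
  have h3 : euclNorm (Z *ᵥ y) = |a i| * euclNorm y := by
    rw [← sq_eq_sq₀ (euclNorm_nonneg _) (mul_nonneg (abs_nonneg _) (euclNorm_nonneg _)),
      ← dotProduct_gram, ← Matrix.mulVec_mulVec, h1, Matrix.mulVec_smul, h2, mul_pow, sq_abs,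
      euclNorm_sq]
    simp [sq, mul_assoc]
  have hy0 : y ≠ 0 := by
    intro h0
    have hx0 : x = 0 := by
      rw [h0, Matrix.mulVec_zero] at h1
      exact (smul_eq_zero.mp h1.symm).resolve_left hai
    have h4 := congrFun (congrFun hU i) i
    rw [Matrix.mul_apply, Fintype.sum_sum_type] at h4
    have e1 : ∀ n, U (Sum.inl n) i = 0 := fun n => congrFun hx0 n
    have e2 : ∀ k, U (Sum.inr k) i = 0 := fun k => congrFun h0 k
    simp [e1, e2] at h4
  have hpos : 0 < euclNorm y :=
    lt_of_le_of_ne (euclNorm_nonneg _) fun h0 => hy0 (euclNorm_eq_zero.mp h0.symm)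
  have h5 := h y
  rw [h3, ← mul_assoc] at h5
  exact le_of_mul_le_mul_right (by linarith) hpos

/-! ### The sign function and local Lipschitz bounds -/

theorem mul_weight_zero_sq (x : ℝ) : x * weight 0 (x ^ 2) = x / |x| := by
  simp [weight, Real.sqrt_sq_eq_abs, div_eq_mul_inv]

/-- The sign jumps by 1 between zero and a nonzero point, at distance at least `1/c`, and by 2
between opposite signs, at distance at least `2/c`. -/
theorem abs_mul_weight_zero_sub_le {c x y : ℝ} (hx : x = 0 ∨ 1 ≤ c * |x|)
    (hy : y = 0 ∨ 1 ≤ c * |y|) :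
    |x * weight 0 (x ^ 2) - y * weight 0 (y ^ 2)| ≤ c * |x - y| := by
  rw [mul_weight_zero_sq, mul_weight_zero_sq]
  rcases eq_or_ne x 0 with rfl | hx0
  · rcases eq_or_ne y 0 with rfl | hy0
    · simp
    · simpa [abs_div, hy0] using hy
  have hx1 := hx.resolve_left hx0
  rcases eq_or_ne y 0 with rfl | hy0
  · simpa [abs_div, hx0] using hx1
  have hy1 := hy.resolve_left hy0
  have hc : 0 ≤ c := by
    by_contra! hc
    nlinarith [abs_nonneg x]
  have hrhs := mul_nonneg hc (abs_nonneg (x - y))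
  rcases lt_or_gt_of_ne hx0 with hx2 | hx2 <;> rcases lt_or_gt_of_ne hy0 with hy2 | hy2
  · rw [abs_of_neg hx2, abs_of_neg hy2, div_neg, div_neg, div_self hx0, div_self hy0]
    simpa using hrhs
  · rw [abs_of_neg hx2] at hx1 ⊢
    rw [abs_of_pos hy2] at hy1 ⊢
    rw [div_neg, div_self hx0, div_self hy0, abs_of_neg (by linarith : x - y < 0),
      abs_of_neg (by norm_num)]
    linarith
  · rw [abs_of_pos hx2] at hx1 ⊢
    rw [abs_of_neg hy2] at hy1 ⊢
    rw [div_neg, div_self hx0, div_self hy0, abs_of_pos (by linarith : 0 < x - y),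
      abs_of_pos (by norm_num)]
    linarith
  · rw [abs_of_pos hx2, abs_of_pos hy2, div_self hx0, div_self hy0]
    simpa using hrhs

theorem abs_owl21_sub_le {N K : ℕ} {c : ℝ} (hc : 0 ≤ c) {Z Z' : Matrix (Fin N) (Fin K) ℝ}
    (h : LowerBound c Z) (h' : LowerBound c Z') :
    |owl21 Z - owl21 Z'| ≤ √(N : ℝ) * c * fro (Z - Z') := by
  obtain ⟨U, a, hU, hUt, hH⟩ := exists_dilation_decomposition Z
  obtain ⟨U', a', hU', hUt', hH'⟩ := exists_dilation_decomposition Z'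
  rw [owl21_eq_Psi_zero, owl21_eq_Psi_zero]
  exact abs_Psi_sub_le le_rfl zero_le_one hc hU hUt hH hU' hUt' hH' fun i j =>
    abs_mul_weight_zero_sub_le (h.eigenvalue hU hH i) (h'.eigenvalue hU' hH' j)

theorem invSqrtNorm_nonneg {N K : ℕ} (Z : Matrix (Fin N) (Fin K) ℝ) : 0 ≤ invSqrtNorm Z :=
  norm_nonneg _

/-- The triangle inequality gives `‖y‖ ≤ c ‖Z y‖ + c ε ‖y‖`; the last term is absorbed on the left
because `c ε < 1`. -/
theorem LowerBound.perturb {N K : ℕ} {c ε : ℝ} (hc : 0 ≤ c) (hε : c * ε < 1)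
    {Z₀ Z : Matrix (Fin N) (Fin K) ℝ} (h : LowerBound c Z₀) (hZ : fro (Z - Z₀) < ε) :
    LowerBound (c / (1 - c * ε)) Z := by
  intro y
  have h1 : euclNorm (Z₀ *ᵥ y) ≤ euclNorm (Z *ᵥ y) + ε * euclNorm y := by
    have e : Z₀ *ᵥ y = Z *ᵥ y + (Z - Z₀) *ᵥ (-y) := by
      simp [Matrix.sub_mulVec, Matrix.mulVec_neg]
    have e2 : euclNorm (-y) = euclNorm y := norm_neg (WithLp.toLp 2 y)
    rw [e]
    refine (euclNorm_add_le _ _).trans (add_le_add_right ((euclNorm_mulVec_le_fro _ _).trans ?_) _)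
    rw [e2]
    exact mul_le_mul_of_nonneg_right hZ.le (euclNorm_nonneg _)
  have h2 := (h y).trans (mul_le_mul_of_nonneg_left h1 hc)
  rw [div_mul_eq_mul_div, le_div_iff₀ (by linarith)]
  linarith

/-- The perturbed constant is continuous in `ε` and equals `s * c` at `ε = 0`, so the strict
inequality leaves room for a positive radius. -/
theorem exists_perturbation_radius {s c L : ℝ} (h : s * c < L) :
    ∃ ε : ℝ, 0 < ε ∧ c * ε < 1 ∧ s * (c / (1 - c * ε)) < L := by
  have h1 : ContinuousAt (fun ε : ℝ => s * (c / (1 - c * ε))) 0 := by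
    refine ContinuousAt.mul continuousAt_const (ContinuousAt.div continuousAt_const ?_ (by simp))
    fun_prop
  have h2 : ContinuousAt (fun ε : ℝ => c * ε) 0 := by fun_prop
  have e1 := h1.eventually_lt_const (u := L) (by simpa using h)
  have e2 := h2.eventually_lt_const (u := 1) (by simp)
  obtain ⟨r, hr, hball⟩ := Metric.eventually_nhds_iff.mp (e2.and e1)
  have := hball (y := r / 2) (by simp [abs_of_pos hr]; linarith)
  exact ⟨r / 2, by linarith, this⟩

end OWL

theorem mainTheorem12 (N K : ℕ) :
    -- the end points of the family
    (∀ Z : Matrix (Fin N) (Fin K) ℝ, OWL.Psi 1 Z = OWL.l21 Z ∧ OWL.Psi 0 Z = OWL.owl21 Z) ∧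
    -- upper bounds
    (∀ γ : ℝ, 0 ≤ γ → γ ≤ 1 → ∀ Z : Matrix (Fin N) (Fin K) ℝ,
      √γ * OWL.Psi γ Z ≤ OWL.l21 Z ∧
      √(1 - γ) * OWL.Psi γ Z ≤ OWL.owl21 Z ∧
      OWL.owl21 Z ≤ √((K : ℝ) * N)) ∧
    -- global Lipschitz continuity for positive parameters
    (∀ γ : ℝ, 0 < γ → γ ≤ 1 → ∀ Z Z' : Matrix (Fin N) (Fin K) ℝ,
      |OWL.Psi γ Z - OWL.Psi γ Z'| ≤ √((N : ℝ) / γ) * OWL.fro (Z - Z')) ∧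
    -- the estimate for pairs of matrices of full column rank
    (∀ Z Z' : Matrix (Fin N) (Fin K) ℝ, IsUnit (Z.transpose * Z) → IsUnit (Z'.transpose * Z') →
      |OWL.owl21 Z - OWL.owl21 Z'| ≤
        √(N : ℝ) * max (OWL.invSqrtNorm Z) (OWL.invSqrtNorm Z') * OWL.fro (Z - Z')) ∧
    -- local Lipschitz continuity near a matrix of full column rank
    (∀ Z₀ : Matrix (Fin N) (Fin K) ℝ, IsUnit (Z₀.transpose * Z₀) →
      ∀ L : ℝ, √(N : ℝ) * OWL.invSqrtNorm Z₀ < L →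
        ∃ ε : ℝ, 0 < ε ∧ ∀ Z Z' : Matrix (Fin N) (Fin K) ℝ,
          OWL.fro (Z - Z₀) < ε → OWL.fro (Z' - Z₀) < ε →
            IsUnit (Z.transpose * Z) ∧ |OWL.owl21 Z - OWL.owl21 Z'| ≤ L * OWL.fro (Z - Z')) := by
  refine ⟨fun Z => ⟨OWL.Psi_one Z, (OWL.owl21_eq_Psi_zero Z).symm⟩,
    fun γ h0 h1 Z => OWL.Psi_upper_bounds h0 h1 Z, ?_, ?_, ?_⟩
  · intro γ h0 h1 Z Z'
    obtain ⟨U, a, hU, hUt, hH⟩ := OWL.exists_dilation_decomposition Z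
    obtain ⟨U', a', hU', hUt', hH'⟩ := OWL.exists_dilation_decomposition Z'
    rw [Real.sqrt_div (Nat.cast_nonneg _), div_eq_mul_inv]
    exact OWL.abs_Psi_sub_le h0.le h1 (by positivity) hU hUt hH hU' hUt' hH' fun i j =>
      OWL.abs_mul_weight_sub_le h0 h1 _ _
  · intro Z Z' hZ hZ'
    exact OWL.abs_owl21_sub_le (le_max_of_le_left (OWL.invSqrtNorm_nonneg Z))
      ((OWL.lowerBound_invSqrtNorm hZ).mono (le_max_left _ _))
      ((OWL.lowerBound_invSqrtNorm hZ').mono (le_max_right _ _))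
  · intro Z₀ hZ₀ L hL
    obtain ⟨ε, hε, hε1, hε2⟩ := OWL.exists_perturbation_radius hL
    have hc := OWL.invSqrtNorm_nonneg Z₀
    refine ⟨ε, hε, fun Z Z' hZ hZ' => ?_⟩
    have h1 := (OWL.lowerBound_invSqrtNorm hZ₀).perturb hc hε1 hZ
    have h2 := (OWL.lowerBound_invSqrtNorm hZ₀).perturb hc hε1 hZ'
    refine ⟨h1.isUnit, (OWL.abs_owl21_sub_le (div_nonneg hc (by linarith)) h1 h2).trans ?_⟩
    exact mul_le_mul_of_nonneg_right hε2.le (Real.sqrt_nonneg _)
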